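/- Let $P$ be the law on $\mathbb{R}^{\mathbb{Z}}$ of a strictly stationary two-sided real sequence $(Z_t)_{t\in\mathbb{Z}}$. For $a\in\mathbb{N}$ let $$\beta(a)=\bigl\|\mathbb{P}_{-\infty:0,\,a:\infty}-\mathbb{P}_{-\infty:0}\otimes\mathbb{P}_{a:\infty}\bigr\|_{\mathrm{TV}}$$ be its $\beta$-mixing coefficient at lag $a$, where $\mathbb{P}_{-\infty:0}$, $\mathbb{P}_{a:\infty}$ and $\mathbb{P}_{-\infty:0,\,a:\infty}$ are the laws of $(Z_t)_{t\le 0}$, of $(Z_t)_{t\ge a}$ and of the pair of the two, and $\|\mu-\nu\|_{\mathrm{TV}}=\sup_A|\mu(A)-\nu(A)|$ over measurable sets $A$. Assume that $P$ is $\beta$-mixing, i.e. $\beta(a)\to0$ as $a\to\infty$. Let $m,a\ge 1$ and $s\ge 0$ be integers, let $n=2ma+s$, and let $Z_1,\dots,Z_n$ be a sample drawn from $P$ (real random variables, on any probability space, whose joint law is the marginal of $P$ at times $1,\dots,n$), with $Z_1\in[0,1]$ almost surely and $\mathrm{Var}[Z_1]=v$. Let $\delta>4(m-1)\beta(a)$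 (the claim is trivial if $\delta\ge1$). Then, with probability at least $1-\delta$, $$\left|\mathbb{E}[Z_1]-\frac1n\sum_{i=1}^n Z_i\right|\le \tilde\sigma(a)\sqrt{\frac4n\log\left(\frac{4}{\delta-4(m-1)\beta(a)}\right)}+\frac1{3m}\log\left(\frac{4}{\delta-4(m-1)\beta(a)}\right)+\frac sn,$$ where $$\tilde\sigma(a)=\sqrt{v+\frac2a\sum_{k=1}^{a-1}(a-k)\beta(k)}.$$ -/

import Mathlib

open MeasureTheory ProbabilityTheory Filter Topology

/-- Total variation distance between two (probability) measures:
`sup_A |μ(A) - ν(A)|` over all measurable sets `A`. -/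
noncomputable def tvDist {X : Type*} [MeasurableSpace X] (μ ν : Measure X) : ℝ :=
  sSup {r : ℝ | ∃ A : Set X, MeasurableSet A ∧ r = |μ.real A - ν.real A|}

/-- A law on two-sided sequences is (strictly) stationary if it is invariant under the time
shift. -/
def IsStationaryLaw {E : Type*} [MeasurableSpace E] (P : Measure (ℤ → E)) : Prop :=
  P.map (fun z t => z (t + 1)) = P

/-- The past `(z_t)_{t ≤ 0}` of a two-sided sequence. -/
def seqPast {E : Type*} (z : ℤ → E) : Set.Iic (0 : ℤ) → E := fun t => z t

/-- The future `(z_t)_{t ≥ a}` of a two-sided sequence. -/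
def seqFuture {E : Type*} (a : ℕ) (z : ℤ → E) : Set.Ici (a : ℤ) → E := fun t => z t

/-- The `β`-mixing coefficient at lag `a`: the total variation distance between the joint law of
`(z_t)_{t ≤ 0}` and `(z_t)_{t ≥ a}` and the product of their laws. -/
noncomputable def betaCoeff {E : Type*} [MeasurableSpace E] (P : Measure (ℤ → E)) (a : ℕ) : ℝ :=
  tvDist (P.map (fun z => (seqPast z, seqFuture a z)))
    ((P.map seqPast).prod (P.map (seqFuture a)))

/-- A law on two-sided sequences is `β`-mixing if `β(a) → 0` as `a → ∞`. -/
def IsBetaMixing {E : Type*} [MeasurableSpace E] (P : Measure (ℤ → E)) : Prop :=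
  Tendsto (betaCoeff P) atTop (𝓝 0)

/-- `σ̃(a) = √(v + (2/a) ∑_{k=1}^{a-1} (a - k) β(k))`. -/
noncomputable def sigmaTilde (β : ℕ → ℝ) (v : ℝ) (a : ℕ) : ℝ :=
  √(v + 2 / (a : ℝ) * ∑ k ∈ Finset.Ico 1 a, ((a : ℝ) - k) * β k)

/-! ### Total variation and integrals. -/

section TotalVariation

variable {X Y : Type*} [MeasurableSpace X] [MeasurableSpace Y]

/-! The proof is Bernstein's inequality applied to block means. Cut the times `1, …, 2ma` into `2m`
consecutive blocks of length `a` and treat the odd and the even blocks separately. Within one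
parity, consecutive blocks are separated by a full block, so replacing the `m` block means by
independent copies, one at a time, changes the probability of any event of their sum by at most `(m
- 1) β(a)` (`IsStationaryLaw.exists_independent_block_sum`).

For independent copies, Bernstein needs only the variance of one block mean. A covariance at lag `k`
is at most `β(k)`, so this variance is at most `σ̃(a)² / a` (`IsStationaryLaw.integral_sum_sq_le`).
The moment generating function of the independent sum is then sub-gamma with variance factor `m
σ̃(a)² / a`, and `measureReal_gt_le_exp_neg_of_subGamma` gives each tail probability `exp (-L)`.

Two parities and two tails cost `4 exp (-L) + 4 (m - 1) β(a)`, which equals `δ` for `L = log (4 / (δ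
- 4 (m - 1) β(a)))`. The `s` leftover terms each deviate from the mean by at most 1, which gives `s
/ n`. -/

theorem abs_measureReal_sub_le_tvDist (μ ν : Measure X) [IsProbabilityMeasure μ]
    [IsProbabilityMeasure ν] {A : Set X} (hA : MeasurableSet A) :
    |μ.real A - ν.real A| ≤ tvDist μ ν := by
  refine le_csSup ⟨1, ?_⟩ ⟨A, hA, rfl⟩
  rintro r ⟨B, -, rfl⟩
  have h1 := measureReal_le_one (μ := μ) (s := B)
  have h2 := measureReal_le_one (μ := ν) (s := B)
  have h3 := measureReal_nonneg (μ := μ) (s := B)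
  have h4 := measureReal_nonneg (μ := ν) (s := B)
  rw [abs_le]
  constructor <;> linarith

theorem tvDist_nonneg (μ ν : Measure X) : 0 ≤ tvDist μ ν := by
  refine Real.sSup_nonneg ?_
  rintro r ⟨B, -, rfl⟩
  exact abs_nonneg _

/-- The integrals of a `[0, 1]`-valued function against two probability measures differ by at
most any uniform bound on the difference of the measures. -/
theorem integral_sub_integral_le_of_forall_measurableSet (μ ν : Measure X)
    [IsProbabilityMeasure μ] [IsProbabilityMeasure ν] {ε : ℝ}
    (h : ∀ A, MeasurableSet A → |μ.real A - ν.real A| ≤ ε) {f : X → ℝ} (hf : Measurable f)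
    (h0 : ∀ x, 0 ≤ f x) (h1 : ∀ x, f x ≤ 1) :
    ∫ x, f x ∂μ - ∫ x, f x ∂ν ≤ ε := by
  have hint : ∀ (ρ : Measure X) [IsProbabilityMeasure ρ], Integrable f ρ := fun ρ _ =>
    Integrable.of_bound hf.aestronglyMeasurable 1
      (ae_of_all _ fun x => by rw [Real.norm_of_nonneg (h0 x)]; exact h1 x)
  have hanti : ∀ (ρ : Measure X) [IsProbabilityMeasure ρ],
      IntegrableOn (fun t => ρ.real {a | t ≤ f a}) (Set.Ioc (0 : ℝ) 1) := fun ρ _ => by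
    have : AntitoneOn (fun t => ρ.real {a | t ≤ f a}) (Set.Icc (0 : ℝ) 1) :=
      fun s _ t _ hst => measureReal_mono fun a ha => hst.trans ha
    exact (this.integrableOn_isCompact isCompact_Icc).mono_set Set.Ioc_subset_Icc_self
  -- Layer cake: each integral is the integral over `t ∈ (0, 1]` of the mass of `{t ≤ f}`, and these
  -- masses differ by at most `ε`. The interval has length 1, so no constant is lost.
  rw [(hint μ).integral_eq_integral_Ioc_meas_le (ae_of_all _ h0) (ae_of_all _ h1),
    (hint ν).integral_eq_integral_Ioc_meas_le (ae_of_all _ h0) (ae_of_all _ h1),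
    ← integral_sub (hanti μ) (hanti ν)]
  calc _ ≤ ∫ _ in Set.Ioc (0 : ℝ) 1, ε := by
        refine integral_mono ((hanti μ).sub (hanti ν)) (integrable_const _) fun t => ?_
        exact (le_abs_self _).trans (h _ (measurableSet_le measurable_const hf))
    _ = ε := by simp

/-- Taking the product with a common probability measure does not increase the distance. -/
theorem abs_prod_measureReal_sub_le (μ ν : Measure X) [IsProbabilityMeasure μ]
    [IsProbabilityMeasure ν] (ρ : Measure Y) [IsProbabilityMeasure ρ] {ε : ℝ}
    (h : ∀ A, MeasurableSet A → |μ.real A - ν.real A| ≤ ε) {A : Set (X × Y)}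
    (hA : MeasurableSet A) :
    |(μ.prod ρ).real A - (ν.prod ρ).real A| ≤ ε := by
  have hsec : ∀ y, MeasurableSet ((fun x => (x, y)) ⁻¹' A) := fun y =>
    measurable_prodMk_right hA
  have hmeas : ∀ (τ : Measure X) [IsProbabilityMeasure τ],
      Measurable fun y => τ ((fun x => (x, y)) ⁻¹' A) := fun τ _ =>
    measurable_measure_prodMk_right hA
  have hreal : ∀ (τ : Measure X) [IsProbabilityMeasure τ],
      (τ.prod ρ).real A = ∫ y, τ.real ((fun x => (x, y)) ⁻¹' A) ∂ρ := fun τ _ => by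
    rw [measureReal_def, Measure.prod_apply_symm hA, integral_eq_lintegral_of_nonneg_ae
      (ae_of_all _ fun _ => measureReal_nonneg) (hmeas τ).ennreal_toReal.aestronglyMeasurable]
    simp [measureReal_def]
  have hint : ∀ (τ : Measure X) [IsProbabilityMeasure τ],
      Integrable (fun y => τ.real ((fun x => (x, y)) ⁻¹' A)) ρ := fun τ _ =>
    Integrable.of_bound (hmeas τ).ennreal_toReal.aestronglyMeasurable 1
      (ae_of_all _ fun y => by
        rw [Real.norm_of_nonneg measureReal_nonneg]; exact measureReal_le_one)
  rw [hreal μ, hreal ν, ← integral_sub (hint μ) (hint ν)]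
  have := norm_integral_le_of_norm_le_const (μ := ρ) (C := ε)
    (f := fun y => μ.real ((fun x => (x, y)) ⁻¹' A) - ν.real ((fun x => (x, y)) ⁻¹' A))
    (ae_of_all _ fun y => by simpa using h _ (hsec y))
  simpa using this

end TotalVariation

/-! ### Bernstein's inequality from a sub-gamma moment generating function. -/

section Bernstein

/-- Since `(n + 2)! ≥ 2 · 3 ^ n`, the exponential series from the quadratic term on is dominated by
a geometric series of ratio `|y| / 3`. -/
theorem Real.exp_le_one_add_add_sq_div {y : ℝ} (hy : |y| < 3) :
    Real.exp y ≤ 1 + y + y ^ 2 / (2 * (1 - |y| / 3)) := by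
  have h1 : HasSum (fun n : ℕ => y ^ n / (n.factorial : ℝ)) (Real.exp y) := by
    rw [Real.exp_eq_exp_ℝ]
    exact NormedSpace.expSeries_div_hasSum_exp y
  have h2 := (hasSum_nat_add_iff' 2).2 h1
  have h3 : HasSum (fun n : ℕ => y ^ 2 / 2 * (|y| / 3) ^ n) (y ^ 2 / 2 * (1 - |y| / 3)⁻¹) :=
    (hasSum_geometric_of_lt_one (by positivity) (by linarith)).mul_left _
  have h4 := hasSum_le (fun n => ?_) h2 h3
  · simp only [Finset.sum_range_succ, Finset.sum_range_zero, pow_zero, Nat.factorial_zero,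
      Nat.cast_one, div_one, zero_add, pow_one, Nat.factorial_one] at h4
    rw [div_mul_eq_div_div, div_eq_mul_inv (y ^ 2 / 2)]
    linarith
  · have hfac : (2 * 3 ^ n : ℝ) ≤ ((n + 2).factorial : ℝ) := by
      have := Nat.factorial_mul_pow_le_factorial (m := 2) (n := n)
      rw [add_comm 2 n] at this
      exact_mod_cast this
    calc y ^ (n + 2) / ((n + 2).factorial : ℝ) ≤ |y| ^ (n + 2) / (2 * 3 ^ n) := by
          exact div_le_div₀ (by positivity) ((le_abs_self _).trans_eq (abs_pow _ _))
            (by positivity) hfac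
      _ = y ^ 2 / 2 * (|y| / 3) ^ n := by
          rw [← sq_abs y, div_pow, pow_add]
          field_simp

/-- Bernstein's bound on the moment generating function of a centred variable in `[-1, 1]`. -/
theorem integral_exp_le_of_abs_le_one {Ω : Type*} [MeasurableSpace Ω] (μ : Measure Ω)
    [IsProbabilityMeasure μ] {X : Ω → ℝ} (hX : Measurable X) (hb : ∀ ω, |X ω| ≤ 1)
    (hmean : ∫ ω, X ω ∂μ = 0) {V : ℝ} (hvar : ∫ ω, X ω ^ 2 ∂μ ≤ V) {l : ℝ} (hl : 0 ≤ l)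
    (hl3 : l < 3) :
    ∫ ω, Real.exp (l * X ω) ∂μ ≤ Real.exp (V * (l ^ 2 / (2 * (1 - l / 3)))) := by
  have hD : 0 < 2 * (1 - l / 3) := by linarith
  have hXi : Integrable X μ := Integrable.of_bound hX.aestronglyMeasurable 1 (ae_of_all _ hb)
  have hX2 : Integrable (fun ω => X ω ^ 2) μ :=
    Integrable.of_bound (hX.pow_const 2).aestronglyMeasurable 1 (ae_of_all _ fun ω => by
      rw [norm_pow]; exact pow_le_one₀ (norm_nonneg _) (hb ω))
  have hexp : Integrable (fun ω => Real.exp (l * X ω)) μ :=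
    Integrable.of_bound (by fun_prop) (Real.exp l) (ae_of_all _ fun ω => by
      rw [Real.norm_eq_abs, Real.abs_exp, Real.exp_le_exp]
      nlinarith [abs_le.1 (hb ω)])
  have hi1 : Integrable (fun ω => 1 + l * X ω) μ := (integrable_const _).add (hXi.const_mul l)
  have hi2 : Integrable (fun ω => X ω ^ 2 * (l ^ 2 / (2 * (1 - l / 3)))) μ := hX2.mul_const _
  calc ∫ ω, Real.exp (l * X ω) ∂μ
      ≤ ∫ ω, (1 + l * X ω) + X ω ^ 2 * (l ^ 2 / (2 * (1 - l / 3))) ∂μ := by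
        refine integral_mono hexp (hi1.add hi2) fun ω => ?_
        have hle : |l * X ω| ≤ l := by
          rw [abs_mul, abs_of_nonneg hl]
          exact mul_le_of_le_one_right hl (hb ω)
        refine (Real.exp_le_one_add_add_sq_div (hle.trans_lt hl3)).trans ?_
        have : (l * X ω) ^ 2 / (2 * (1 - |l * X ω| / 3)) ≤ (l * X ω) ^ 2 / (2 * (1 - l / 3)) := by
          gcongr
        rw [mul_pow] at this ⊢
        rw [mul_div_assoc', mul_comm (X ω ^ 2)]
        linarith
    _ = 1 + (∫ ω, X ω ^ 2 ∂μ) * (l ^ 2 / (2 * (1 - l / 3))) := by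
        rw [integral_add hi1 hi2, integral_add (integrable_const _) (hXi.const_mul l),
          integral_const_mul, integral_mul_const, hmean]
        simp
    _ ≤ 1 + V * (l ^ 2 / (2 * (1 - l / 3))) := by gcongr
    _ ≤ _ := by rw [add_comm]; exact Real.add_one_le_exp _

/-- A sub-gamma bound on the moment generating function gives a Bernstein tail bound. -/
theorem measureReal_gt_le_exp_neg_of_subGamma {Ω : Type*} [MeasurableSpace Ω] (μ : Measure Ω)
    [IsProbabilityMeasure μ] {X : Ω → ℝ} {V : ℝ} (hV : 0 ≤ V)
    (hint : ∀ l : ℝ, Integrable (fun ω => Real.exp (l * X ω)) μ)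
    (hmgf : ∀ l : ℝ, 0 ≤ l → l < 3 →
      ∫ ω, Real.exp (l * X ω) ∂μ ≤ Real.exp (V * (l ^ 2 / (2 * (1 - l / 3)))))
    {L : ℝ} (hL : 0 < L) :
    μ.real {ω | √(2 * V * L) + L / 3 < X ω} ≤ Real.exp (-L) := by
  set t := √(2 * V * L) + L / 3 with ht
  have hchern : ∀ l : ℝ, 0 ≤ l → l < 3 →
      μ.real {ω | t < X ω} ≤ Real.exp (-l * t + V * (l ^ 2 / (2 * (1 - l / 3)))) := by
    intro l h0 h3
    rw [Real.exp_add]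
    calc μ.real {ω | t < X ω} ≤ μ.real {ω | t ≤ X ω} :=
          measureReal_mono fun ω (hω : t < X ω) => hω.le
      _ ≤ Real.exp (-l * t) * mgf X μ l := measure_ge_le_exp_mul_mgf t h0 (hint l)
      _ ≤ _ := by
          gcongr
          exact hmgf l h0 h3
  -- For `V = 0` the Chernoff exponent has no minimiser below 3. Letting `l → 3` gives `exp (-3 t)`
  -- with `t = L / 3`.
  rcases hV.eq_or_lt with rfl | hV
  · have ht' : t = L / 3 := by simp [ht]
    have hcont : Tendsto (fun l : ℝ => Real.exp (-l * t)) (𝓝[<] 3) (𝓝 (Real.exp (-3 * t))) :=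
      Tendsto.mono_left (Continuous.tendsto (by fun_prop) 3) nhdsWithin_le_nhds
    have : μ.real {ω | t < X ω} ≤ Real.exp (-3 * t) := by
      refine ge_of_tendsto hcont ?_
      filter_upwards [Ioo_mem_nhdsLT (show (0 : ℝ) < 3 by norm_num)] with l hl
      simpa using hchern l hl.1.le hl.2
    refine this.trans_eq ?_
    rw [ht']
    congr 1
    ring
  -- The minimiser of the Chernoff exponent is `l = r / (1 + r / 3)`. There `1 - l / 3 = 1 / (1 + r
  -- / 3)`, and the exponent is exactly `-V r² / 2 = -L`.
  · set r := √(2 * L / V) with hr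
    have hr0 : 0 < r := Real.sqrt_pos.2 (by positivity)
    have hr2 : V * r ^ 2 = 2 * L := by
      rw [hr, Real.sq_sqrt (by positivity)]
      field_simp
    have hsqrt : √(2 * V * L) = V * r := by
      rw [Real.sqrt_eq_iff_mul_self_eq (by positivity) (by positivity)]
      linear_combination (-V) * hr2
    refine (hchern (r / (1 + r / 3)) (by positivity) ?_).trans_eq ?_
    · rw [div_lt_iff₀ (by positivity)]
      linarith
    · congr 1
      have h1 : 1 - r / (1 + r / 3) / 3 = 1 / (1 + r / 3) := by
        field_simp
        ring
      rw [h1, ht, hsqrt]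
      have hLr : L = V * r ^ 2 / 2 := by linarith
      rw [hLr]
      field_simp
      ring

end Bernstein

/-! ### Stationarity, decoupling of past and future, and covariances. -/

section Stationary

variable {E : Type*} [MeasurableSpace E] {P : Measure (ℤ → E)}

theorem IsStationaryLaw.measurePreserving_shift (hP : IsStationaryLaw P) (c : ℕ) :
    MeasurePreserving (fun (z : ℤ → E) (t : ℤ) => z (t + c)) P P := by
  induction c with
  | zero => simpa using! MeasurePreserving.id P
  | succ c ih =>
    have h1 : MeasurePreserving (fun (z : ℤ → E) (t : ℤ) => z (t + 1)) P P :=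
      ⟨by fun_prop, hP⟩
    convert h1.comp ih using 1
    funext z t
    simp only [Function.comp_apply, Nat.cast_add, Nat.cast_one]
    congr 1
    ring

theorem betaCoeff_nonneg (P : Measure (ℤ → E)) (a : ℕ) : 0 ≤ betaCoeff P a := tvDist_nonneg _ _

variable {X Y : Type*} [MeasurableSpace X] [MeasurableSpace Y]

theorem measurable_seqPast : Measurable (seqPast : (ℤ → E) → Set.Iic (0 : ℤ) → E) :=
  measurable_pi_lambda _ fun _ => measurable_pi_apply _

theorem measurable_seqFuture (a : ℕ) :
    Measurable (seqFuture a : (ℤ → E) → Set.Ici (a : ℤ) → E) :=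
  measurable_pi_lambda _ fun _ => measurable_pi_apply _

/-- A function of the past and a function of the future are `β(a)`-close to independent. -/
theorem abs_map_prodMk_sub_prod_le_betaCoeff_zero [IsProbabilityMeasure P] {a : ℕ}
    {F : (ℤ → E) → X} {G : (ℤ → E) → Y} (hF : Measurable F) (hG : Measurable G)
    (hFd : DependsOn F (Set.Iic 0)) (hGd : DependsOn G (Set.Ici (a : ℤ)))
    {A : Set (X × Y)} (hA : MeasurableSet A) :
    |(P.map fun z => (F z, G z)).real A - ((P.map F).prod (P.map G)).real A|
      ≤ betaCoeff P a := by
  -- Clamping the time index extends a half-line configuration to all of `ℤ` without needing a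
  -- default element of `E`.
  set F' : (Set.Iic (0 : ℤ) → E) → X := fun w => F fun t => w ⟨min t 0, Set.mem_Iic.2 (min_le_right _ _)⟩
    with hF'
  set G' : (Set.Ici (a : ℤ) → E) → Y := fun w => G fun t => w ⟨max t a, Set.mem_Ici.2 (le_max_right _ _)⟩
    with hG'
  have hF'm : Measurable F' :=
    hF.comp (measurable_pi_lambda _ fun _ => measurable_pi_apply _)
  have hG'm : Measurable G' :=
    hG.comp (measurable_pi_lambda _ fun _ => measurable_pi_apply _)
  have hFe : F = F' ∘ seqPast := by
    funext z
    refine hFd fun t ht => ?_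
    simp only [seqPast]
    rw [min_eq_left ht]
  have hGe : G = G' ∘ seqFuture a := by
    funext z
    refine hGd fun t ht => ?_
    simp only [seqFuture]
    rw [max_eq_left ht]
  have hpair : Measurable fun z : ℤ → E => (seqPast z, seqFuture a z) :=
    measurable_seqPast.prodMk (measurable_seqFuture a)
  have e1 : (P.map fun z => (F z, G z))
      = (P.map fun z => (seqPast z, seqFuture a z)).map (Prod.map F' G') := by
    rw [Measure.map_map (hF'm.prodMap hG'm) hpair, hFe, hGe]
    rfl
  have := Measure.isProbabilityMeasure_map (μ := P) measurable_seqPast.aemeasurable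
  have := Measure.isProbabilityMeasure_map (μ := P) (measurable_seqFuture a).aemeasurable
  have := Measure.isProbabilityMeasure_map (μ := P) hpair.aemeasurable
  have e2 : (P.map F).prod (P.map G)
      = ((P.map seqPast).prod (P.map (seqFuture a))).map (Prod.map F' G') := by
    rw [← Measure.map_prod_map _ _ hF'm hG'm, Measure.map_map hF'm measurable_seqPast,
      Measure.map_map hG'm (measurable_seqFuture a), ← hFe, ← hGe]
  rw [e1, e2, map_measureReal_apply (hF'm.prodMap hG'm) hA,
    map_measureReal_apply (hF'm.prodMap hG'm) hA]
  exact abs_measureReal_sub_le_tvDist _ _ (hF'm.prodMap hG'm hA)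

/-- Invariance is available for forward shifts. Writing `P` as its own image under the forward shift
by `d` cancels the backward one. -/
theorem IsStationaryLaw.map_comp_unshift (hP : IsStationaryLaw P) (d : ℕ) {F : (ℤ → E) → X}
    (hF : Measurable F) : (P.map fun z => F fun t => z (t - d)) = P.map F := by
  have hback : Measurable fun (z : ℤ → E) (t : ℤ) => z (t - d) := by fun_prop
  have hshift := hP.measurePreserving_shift d
  have hFb : Measurable fun z : ℤ → E => F fun t => z (t - d) := hF.comp hback
  conv_lhs => rw [← hshift.map_eq]
  rw [Measure.map_map hFb hshift.measurable]
  congr 1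
  funext z
  simp

theorem abs_map_prodMk_sub_prod_le_betaCoeff [IsProbabilityMeasure P] (hP : IsStationaryLaw P)
    {a d : ℕ} {F : (ℤ → E) → X} {G : (ℤ → E) → Y} (hF : Measurable F) (hG : Measurable G)
    (hFd : DependsOn F (Set.Iic (d : ℤ))) (hGd : DependsOn G (Set.Ici ((d : ℤ) + a)))
    {A : Set (X × Y)} (hA : MeasurableSet A) :
    |(P.map fun z => (F z, G z)).real A - ((P.map F).prod (P.map G)).real A|
      ≤ betaCoeff P a := by
  have hback : Measurable fun (z : ℤ → E) (t : ℤ) => z (t - d) := by fun_prop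
  rw [← hP.map_comp_unshift d (hF.prodMk hG), ← hP.map_comp_unshift d hF,
    ← hP.map_comp_unshift d hG]
  refine abs_map_prodMk_sub_prod_le_betaCoeff_zero (hF.comp hback) (hG.comp hback) ?_ ?_ hA
  · intro x y hxy
    exact hFd fun t ht => hxy _ (by simp only [Set.mem_Iic] at *; lia)
  · intro x y hxy
    exact hGd fun t ht => hxy _ (by simp only [Set.mem_Ici] at *; lia)

theorem IsStationaryLaw.integral_comp_eval (hP : IsStationaryLaw P) (c : ℕ) {f : E → ℝ}
    (hf : Measurable f) :
    ∫ z, f (z c) ∂P = ∫ z, f (z 0) ∂P := by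
  have h := hP.measurePreserving_shift c
  have := integral_map (μ := P) h.measurable.aemeasurable (f := fun z : ℤ → E => f (z 0))
    (hf.comp (measurable_pi_apply 0)).aestronglyMeasurable
  rw [h.map_eq] at this
  simpa using this.symm

/-- The uncentred product takes values in `[0, 1]`, so the covariance is bounded by `β(k)` with
constant 1; using only that the centred product lies in `[-1, 1]` would lose a factor 2. -/
theorem IsStationaryLaw.integral_mul_sub_le [IsProbabilityMeasure P] (hP : IsStationaryLaw P)
    {f : E → ℝ} (hf : Measurable f) (h0 : ∀ x, 0 ≤ f x) (h1 : ∀ x, f x ≤ 1) (i k : ℕ) :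
    ∫ z, f (z i) * f (z (i + k : ℕ)) ∂P - (∫ z, f (z 0) ∂P) ^ 2 ≤ betaCoeff P k := by
  have hm : ∀ j : ℕ, Measurable fun z : ℤ → E => f (z j) := fun j =>
    hf.comp (measurable_pi_apply _)
  have := fun j => Measure.isProbabilityMeasure_map (μ := P) (hm j).aemeasurable
  have := Measure.isProbabilityMeasure_map (μ := P) ((hm i).prodMk (hm (i + k))).aemeasurable
  -- The test function must be `[0, 1]`-valued on the whole plane, so `xy` is clipped; clipping is
  -- invisible on values of `f`.
  have hclip : Measurable fun x : ℝ => max 0 (min 1 x) := by fun_prop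
  have hid : ∀ x, max 0 (min 1 (f x)) = f x := fun x => by
    rw [min_eq_right (h1 x), max_eq_right (h0 x)]
  have hi0 : ∀ x : ℝ, 0 ≤ max 0 (min 1 x) := fun x => le_max_left _ _
  have hi1 : ∀ x : ℝ, max 0 (min 1 x) ≤ 1 := fun x => max_le zero_le_one (min_le_left _ _)
  have key := integral_sub_integral_le_of_forall_measurableSet
    (P.map fun z => (f (z i), f (z (i + k : ℕ))))
    ((P.map fun z => f (z i)).prod (P.map fun z => f (z (i + k : ℕ))))
    (ε := betaCoeff P k)
    (fun A hA => abs_map_prodMk_sub_prod_le_betaCoeff hP (d := i) (hm i) (hm (i + k))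
      (fun x y h => by simp only [h i (Set.mem_Iic.2 le_rfl)])
      (fun x y h => by simp only [h (i + k : ℕ) (by simp)]) hA)
    (f := fun p => max 0 (min 1 p.1) * max 0 (min 1 p.2)) (by fun_prop)
    (fun p => mul_nonneg (hi0 _) (hi0 _)) (fun p => mul_le_one₀ (hi1 _) (hi0 _) (hi1 _))
  rw [integral_map ((hm i).prodMk (hm (i + k))).aemeasurable
      (Measurable.aestronglyMeasurable (by fun_prop)),
    integral_prod_mul (fun x : ℝ => max 0 (min 1 x)) (fun x : ℝ => max 0 (min 1 x)),
    integral_map (hm i).aemeasurable hclip.aestronglyMeasurable,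
    integral_map (hm (i + k)).aemeasurable hclip.aestronglyMeasurable] at key
  simp only [hid] at key
  rw [hP.integral_comp_eval i hf, hP.integral_comp_eval (i + k) hf, ← sq] at key
  exact key

/-- The second moment of a sum of `a` consecutive centred terms. -/
theorem IsStationaryLaw.integral_sum_sq_le [IsProbabilityMeasure P] (hP : IsStationaryLaw P)
    {f : E → ℝ} (hf : Measurable f) (h0 : ∀ x, 0 ≤ f x) (h1 : ∀ x, f x ≤ 1) {p v : ℝ}
    (hp : ∫ z, f (z 0) ∂P = p) (hv : ∫ z, (f (z 0) - p) ^ 2 ∂P = v) (a : ℕ) :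
    ∫ z, (∑ i ∈ Finset.range a, (f (z (i + 1 : ℕ)) - p)) ^ 2 ∂P
      ≤ a * v + 2 * ∑ k ∈ Finset.Ico 1 a, ((a : ℝ) - k) * betaCoeff P k := by
  set g : ℕ → (ℤ → E) → ℝ := fun i z => f (z (i + 1 : ℕ)) - p with hg
  have hgm : ∀ i, Measurable (g i) := fun i =>
    (hf.comp (measurable_pi_apply _)).sub_const p
  have hp0 : 0 ≤ p := hp ▸ integral_nonneg fun z => h0 _
  have hp1 : p ≤ 1 := by
    rw [← hp]
    refine (integral_mono_of_nonneg (ae_of_all _ fun z => h0 _) (integrable_const 1)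
      (ae_of_all _ fun z => h1 _)).trans (by simp)
  have hgb : ∀ i z, |g i z| ≤ 1 := fun i z => by
    rw [abs_le]
    have := h0 (z (i + 1 : ℕ))
    have := h1 (z (i + 1 : ℕ))
    constructor <;> simp only [hg] <;> linarith
  have hfi : ∀ j : ℕ, Integrable (fun z : ℤ → E => f (z j)) P := fun j =>
    Integrable.of_bound (hf.comp (measurable_pi_apply _)).aestronglyMeasurable 1
      (ae_of_all _ fun z => by rw [Real.norm_of_nonneg (h0 _)]; exact h1 _)
  have hff : ∀ i j : ℕ, Integrable (fun z : ℤ → E => f (z i) * f (z j)) P := fun i j =>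
    Integrable.of_bound ((hf.comp (measurable_pi_apply _)).mul
      (hf.comp (measurable_pi_apply _))).aestronglyMeasurable 1
      (ae_of_all _ fun z => by
        rw [Real.norm_of_nonneg (mul_nonneg (h0 _) (h0 _))]
        exact mul_le_one₀ (h1 _) (h0 _) (h1 _))
  have hgg : ∀ i j, Integrable (fun z => g i z * g j z) P := fun i j =>
    Integrable.of_bound ((hgm i).mul (hgm j)).aestronglyMeasurable 1
      (ae_of_all _ fun z => by
        rw [norm_mul]; exact mul_le_one₀ (hgb _ _) (norm_nonneg _) (hgb _ _))
  have hdiag : ∀ i, ∫ z, g i z * g i z ∂P = v := fun i => by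
    rw [← hv, ← hP.integral_comp_eval (i + 1) (f := fun x => (f x - p) ^ 2) (by fun_prop)]
    simp only [hg, sq]
  have hoff : ∀ i k, ∫ z, g i z * g (i + k) z ∂P ≤ betaCoeff P k := fun i k => by
    have h := hP.integral_mul_sub_le hf h0 h1 (i + 1) k
    have e : ∀ z, g i z * g (i + k) z
        = f (z (i + 1 : ℕ)) * f (z (i + 1 + k : ℕ)) - p * f (z (i + 1 : ℕ))
          - p * f (z (i + 1 + k : ℕ)) + p ^ 2 := fun z => by
      simp only [hg]
      rw [show i + k + 1 = i + 1 + k by ring]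
      ring
    simp_rw [e]
    have hi1 : Integrable (fun z : ℤ → E => f (z (i + 1 : ℕ)) * f (z (i + 1 + k : ℕ))
        - p * f (z (i + 1 : ℕ))) P := (hff _ _).sub ((hfi _).const_mul p)
    have hi2 : Integrable (fun z : ℤ → E => f (z (i + 1 : ℕ)) * f (z (i + 1 + k : ℕ))
        - p * f (z (i + 1 : ℕ)) - p * f (z (i + 1 + k : ℕ))) P :=
      hi1.sub ((hfi _).const_mul p)
    rw [integral_add hi2 (integrable_const _), integral_sub hi1 ((hfi _).const_mul p),
      integral_sub (hff _ _) ((hfi _).const_mul p), integral_const_mul, integral_const_mul,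
      hP.integral_comp_eval _ hf, hP.integral_comp_eval _ hf, hp]
    rw [hp] at h
    simp only [integral_const, probReal_univ, one_smul]
    linarith
  change ∫ z, (∑ i ∈ Finset.range a, g i z) ^ 2 ∂P ≤ _
  -- A new last term contributes its variance `v` and twice its covariances at lags `1, …, a`.
  -- Correspondingly, every weight `a - k` grows by one.
  induction a with
  | zero => simp
  | succ a ih =>
    have e : ∀ z, (∑ i ∈ Finset.range (a + 1), g i z) ^ 2
        = ((∑ i ∈ Finset.range a, g i z) ^ 2 + 2 * ∑ i ∈ Finset.range a, g i z * g a z)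
          + g a z * g a z := fun z => by
      rw [Finset.sum_range_succ, ← Finset.sum_mul]
      ring
    have hS : Integrable (fun z => (∑ i ∈ Finset.range a, g i z) ^ 2) P := by
      simp_rw [sq, Finset.sum_mul_sum]
      exact integrable_finsetSum _ fun i _ => integrable_finsetSum _ fun j _ => hgg i j
    have hC : Integrable (fun z => ∑ i ∈ Finset.range a, g i z * g a z) P :=
      integrable_finsetSum _ fun i _ => hgg i a
    have hSC : Integrable (fun z => (∑ i ∈ Finset.range a, g i z) ^ 2
        + 2 * ∑ i ∈ Finset.range a, g i z * g a z) P := hS.add (hC.const_mul 2)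
    simp_rw [e]
    rw [integral_add hSC (hgg a a), integral_add hS (hC.const_mul 2),
      integral_const_mul, integral_finsetSum _ fun i _ => hgg i a, hdiag]
    have hcross : ∑ i ∈ Finset.range a, ∫ z, g i z * g a z ∂P
        ≤ ∑ k ∈ Finset.Ico 1 (a + 1), betaCoeff P k := by
      -- Reflection reindexes the earlier terms by their lag to the last one.
      rw [Finset.sum_Ico_eq_sum_range, ← Finset.sum_range_reflect]
      refine Finset.sum_le_sum fun i hi => ?_
      have hi := Finset.mem_range.1 hi
      have := hoff (a - 1 - i) (1 + i)
      rwa [show a - 1 - i + (1 + i) = a by lia] at this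
    have hsplit : ∑ k ∈ Finset.Ico 1 (a + 1), (((a + 1 : ℕ) : ℝ) - k) * betaCoeff P k
        = ∑ k ∈ Finset.Ico 1 a, ((a : ℝ) - k) * betaCoeff P k
          + ∑ k ∈ Finset.Ico 1 (a + 1), betaCoeff P k := by
      rcases Nat.eq_zero_or_pos a with rfl | ha
      · simp
      · rw [Finset.sum_Ico_succ_top ha, Finset.sum_Ico_succ_top ha, ← add_assoc,
          ← Finset.sum_add_distrib]
        push_cast
        congr 1
        · exact Finset.sum_congr rfl fun k _ => by ring
        · ring
    rw [hsplit]
    push_cast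
    linarith

end Stationary

/-! ### Coupling alternate blocks with independent copies. -/

section Blocks

/-- The average of `f(z_t) - p` over the block of times `c + 1, …, c + a`. -/
noncomputable def centeredBlockMean {E : Type*} (f : E → ℝ) (p : ℝ) (a c : ℕ) (z : ℤ → E) : ℝ :=
  (∑ i ∈ Finset.range a, (f (z (c + i + 1 : ℕ)) - p)) / a

variable {E : Type*} {f : E → ℝ} {p : ℝ} {a : ℕ}

theorem dependsOn_centeredBlockMean (c : ℕ) {s : Set ℤ}
    (hs : ∀ i < a, ((c + i + 1 : ℕ) : ℤ) ∈ s) : DependsOn (centeredBlockMean f p a c) s := by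
  intro x y hxy
  unfold centeredBlockMean
  congr 1
  refine Finset.sum_congr rfl fun i hi => ?_
  rw [hxy _ (hs i (Finset.mem_range.1 hi))]

theorem abs_centeredBlockMean_le (h0 : ∀ x, 0 ≤ f x) (h1 : ∀ x, f x ≤ 1) (hp0 : 0 ≤ p)
    (hp1 : p ≤ 1) (c : ℕ) (z : ℤ → E) : |centeredBlockMean f p a c z| ≤ 1 := by
  unfold centeredBlockMean
  rw [abs_div, Nat.abs_cast]
  refine div_le_one_of_le₀ ?_ (Nat.cast_nonneg _)
  refine (Finset.abs_sum_le_sum_abs _ _).trans ?_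
  refine (Finset.sum_le_card_nsmul _ _ 1 fun i _ => ?_).trans (by simp)
  have := h0 (z (c + i + 1 : ℕ))
  have := h1 (z (c + i + 1 : ℕ))
  rw [abs_le]
  constructor <;> linarith

variable [MeasurableSpace E]

theorem measurable_centeredBlockMean (hf : Measurable f) (p : ℝ) (a c : ℕ) :
    Measurable (centeredBlockMean f p a c) := by
  unfold centeredBlockMean
  fun_prop

variable {P : Measure (ℤ → E)}

theorem IsStationaryLaw.map_centeredBlockMean (hP : IsStationaryLaw P) (hf : Measurable f)
    (p : ℝ) (a c : ℕ) :
    P.map (centeredBlockMean f p a c) = P.map (centeredBlockMean f p a 0) := by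
  have hs := hP.measurePreserving_shift c
  conv_rhs => rw [← hs.map_eq]
  rw [Measure.map_map (measurable_centeredBlockMean hf p a 0) hs.measurable]
  congr 1
  funext z
  simp only [centeredBlockMean, Function.comp_apply]
  congr 1
  refine Finset.sum_congr rfl fun i _ => ?_
  congr 3
  push_cast
  ring

/-- The law of the sum of the means of `k + 1` blocks separated by gaps of length `a` is
`k β(a)`-close to the law of a sum of independent copies. -/
theorem IsStationaryLaw.exists_independent_block_sum [IsProbabilityMeasure P]
    (hP : IsStationaryLaw P) (hf : Measurable f) (h0 : ∀ x, 0 ≤ f x) (h1 : ∀ x, f x ≤ 1)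
    (hp0 : 0 ≤ p) (hp1 : p ≤ 1) (a c k : ℕ) :
    ∃ ρ : Measure ℝ, IsProbabilityMeasure ρ ∧
      (∀ A, MeasurableSet A →
        |(P.map fun z => ∑ j ∈ Finset.range (k + 1),
            centeredBlockMean f p a (c + 2 * a * j) z).real A - ρ.real A|
          ≤ k * betaCoeff P a) ∧
      ∀ l : ℝ, Integrable (fun x => Real.exp (l * x)) ρ ∧
        ∫ x, Real.exp (l * x) ∂ρ
          = (∫ z, Real.exp (l * centeredBlockMean f p a 0 z) ∂P) ^ (k + 1) := by
  have hW := measurable_centeredBlockMean hf p a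
  set ν := P.map (centeredBlockMean f p a 0) with hν
  have hνP : IsProbabilityMeasure ν := Measure.isProbabilityMeasure_map (hW 0).aemeasurable
  have hνi : ∀ l : ℝ, Integrable (fun x => Real.exp (l * x)) ν := fun l => by
    rw [hν, integrable_map_measure (by fun_prop) (hW 0).aemeasurable]
    refine Integrable.of_bound (Measurable.aestronglyMeasurable ?_) (Real.exp |l|)
      (ae_of_all _ fun z => ?_)
    · exact Measurable.comp (by fun_prop) (hW 0)
    · rw [Function.comp_apply, Real.norm_eq_abs, Real.abs_exp, Real.exp_le_exp]
      refine (le_abs_self _).trans ?_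
      rw [abs_mul]
      exact mul_le_of_le_one_right (abs_nonneg _) (abs_centeredBlockMean_le h0 h1 hp0 hp1 0 z)
  have hνe : ∀ l : ℝ, ∫ x, Real.exp (l * x) ∂ν
      = ∫ z, Real.exp (l * centeredBlockMean f p a 0 z) ∂P := fun l =>
    integral_map (hW 0).aemeasurable (by fun_prop)
  induction k with
  | zero =>
    refine ⟨ν, hνP, fun A _ => ?_, fun l => ⟨hνi l, by rw [hνe]; simp⟩⟩
    simp only [zero_add, Finset.sum_range_one, mul_zero, add_zero, Nat.cast_zero, zero_mul]
    rw [show (P.map fun z => centeredBlockMean f p a c z) = ν from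
      hP.map_centeredBlockMean hf p a c]
    simp
  | succ k ih =>
    obtain ⟨ρ, hρP, hρA, hρe⟩ := ih
    set S : (ℤ → E) → ℝ := fun z => ∑ j ∈ Finset.range (k + 1),
      centeredBlockMean f p a (c + 2 * a * j) z with hS
    have hSm : Measurable S := Finset.measurable_sum _ fun j _ => hW _
    have hSP : IsProbabilityMeasure (P.map S) :=
      Measure.isProbabilityMeasure_map hSm.aemeasurable
    have hadd : Measurable fun q : ℝ × ℝ => q.1 + q.2 := by fun_prop
    have hsum : (P.map fun z => ∑ j ∈ Finset.range (k + 1 + 1),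
          centeredBlockMean f p a (c + 2 * a * j) z)
        = (P.map fun z => (S z, centeredBlockMean f p a (c + 2 * a * (k + 1)) z)).map
            fun q => q.1 + q.2 := by
      rw [Measure.map_map hadd (hSm.prodMk (hW _))]
      congr 1
      funext z
      rw [Finset.sum_range_succ]
      rfl
    refine ⟨(ρ.prod ν).map fun q => q.1 + q.2,
      Measure.isProbabilityMeasure_map hadd.aemeasurable, fun A hA => ?_, fun l => ?_⟩
    · rw [hsum, map_measureReal_apply hadd hA, map_measureReal_apply hadd hA]
      -- `h3` decouples the new block from the earlier ones at cost `β(a)`; `h2` then replaces the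
      -- law of the earlier sum by `ρ` at cost `k β(a)`. The time `d = c + 2ak + a` is the last one
      -- of the earlier blocks. The new block starts at `d + a + 1`, which lies in the future at lag
      -- `a`.
      have h2 := abs_prod_measureReal_sub_le (P.map S) ρ ν hρA (hadd hA)
      have h3 := abs_map_prodMk_sub_prod_le_betaCoeff hP (a := a) (d := c + 2 * a * k + a)
        hSm (hW (c + 2 * a * (k + 1))) ?_ ?_ (hadd hA)
      · rw [hP.map_centeredBlockMean hf] at h3
        refine (abs_sub_le _ _ _).trans ((add_le_add h3 h2).trans_eq ?_)
        push_cast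
        ring
      · intro x y hxy
        refine Finset.sum_congr rfl fun j hj => ?_
        refine dependsOn_centeredBlockMean _ (fun i hi => ?_) hxy
        have hj : a * j ≤ a * k := Nat.mul_le_mul_left _ (Nat.lt_succ_iff.1 (Finset.mem_range.1 hj))
        rw [Set.mem_Iic, Nat.cast_le]
        lia
      · refine dependsOn_centeredBlockMean _ fun i _ => ?_
        rw [Set.mem_Ici, ← Nat.cast_add, Nat.cast_le]
        lia
    · have hm : AEStronglyMeasurable (fun x : ℝ => Real.exp (l * x))
          ((ρ.prod ν).map fun q => q.1 + q.2) := by fun_prop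
      have hexp : ((fun x : ℝ => Real.exp (l * x)) ∘ fun q : ℝ × ℝ => q.1 + q.2)
          = fun q => Real.exp (l * q.1) * Real.exp (l * q.2) := by
        funext q
        rw [Function.comp_apply, mul_add, Real.exp_add]
      constructor
      · rw [integrable_map_measure hm hadd.aemeasurable, hexp]
        exact (hρe l).1.mul_prod (hνi l)
      · rw [integral_map hadd.aemeasurable hm]
        change ∫ q, ((fun x : ℝ => Real.exp (l * x)) ∘ fun q : ℝ × ℝ => q.1 + q.2) q
          ∂(ρ.prod ν) = _
        rw [hexp, integral_prod_mul (fun x : ℝ => Real.exp (l * x))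
          (fun x : ℝ => Real.exp (l * x)), (hρe l).2, hνe, ← pow_succ]

/-- One-sided Bernstein inequality for sums over alternate blocks of a stationary sequence. -/
theorem IsStationaryLaw.measureReal_block_sum_gt_le [IsProbabilityMeasure P]
    (hP : IsStationaryLaw P) (hf : Measurable f) (h0 : ∀ x, 0 ≤ f x) (h1 : ∀ x, f x ≤ 1)
    {v : ℝ} (hp : ∫ z, f (z 0) ∂P = p) (hv : ∫ z, (f (z 0) - p) ^ 2 ∂P = v) {m : ℕ}
    (hm : 1 ≤ m) (ha : 1 ≤ a) (c : ℕ) {L : ℝ} (hL : 0 < L) :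
    P.real {z | √(2 * (m * (sigmaTilde (betaCoeff P) v a ^ 2 / a)) * L) + L / 3
        < ∑ j ∈ Finset.range m, centeredBlockMean f p a (c + 2 * a * j) z}
      ≤ Real.exp (-L) + (m - 1) * betaCoeff P a := by
  have hp0 : 0 ≤ p := hp ▸ integral_nonneg fun z => h0 _
  have hp1 : p ≤ 1 := by
    rw [← hp]
    exact (integral_mono_of_nonneg (ae_of_all _ fun z => h0 _) (integrable_const 1)
      (ae_of_all _ fun z => h1 _)).trans (by simp)
  have hW := measurable_centeredBlockMean hf p a
  have ha' : (0 : ℝ) < a := by exact_mod_cast ha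
  have hmean : ∫ z, centeredBlockMean f p a 0 z ∂P = 0 := by
    have hfi : ∀ j : ℕ, Integrable (fun z : ℤ → E => f (z j)) P := fun j =>
      Integrable.of_bound (hf.comp (measurable_pi_apply _)).aestronglyMeasurable 1
        (ae_of_all _ fun z => by rw [Real.norm_of_nonneg (h0 _)]; exact h1 _)
    unfold centeredBlockMean
    have hfp : ∀ j : ℕ, Integrable (fun z : ℤ → E => f (z j) - p) P := fun j =>
      (hfi j).sub (integrable_const p)
    rw [integral_div, integral_finsetSum _ fun i _ => hfp _]
    rw [Finset.sum_eq_zero fun i _ => ?_, zero_div]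
    rw [integral_sub (hfi _) (integrable_const p), hP.integral_comp_eval _ hf, hp]
    simp
  -- The block sum has second moment at most `a σ̃(a)²`; the mean divides this by `a²`.
  have hvar : ∫ z, centeredBlockMean f p a 0 z ^ 2 ∂P
      ≤ sigmaTilde (betaCoeff P) v a ^ 2 / a := by
    have hv0 : 0 ≤ v := hv ▸ integral_nonneg fun z => sq_nonneg _
    have hβ : 0 ≤ ∑ k ∈ Finset.Ico 1 a, ((a : ℝ) - k) * betaCoeff P k :=
      Finset.sum_nonneg fun k hk => mul_nonneg
        (sub_nonneg.2 (Nat.cast_le.2 (Finset.mem_Ico.1 hk).2.le)) (betaCoeff_nonneg P k)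
    rw [sigmaTilde, Real.sq_sqrt (by positivity)]
    have h := hP.integral_sum_sq_le hf h0 h1 hp hv a
    unfold centeredBlockMean
    simp_rw [div_pow, zero_add]
    rw [integral_div, div_le_iff₀ (by positivity)]
    refine h.trans_eq ?_
    field_simp
  obtain ⟨k, rfl⟩ : ∃ k, m = k + 1 := ⟨m - 1, by lia⟩
  obtain ⟨ρ, hρP, hρA, hρe⟩ := hP.exists_independent_block_sum hf h0 h1 hp0 hp1 a c k
  have htail := measureReal_gt_le_exp_neg_of_subGamma ρ (X := fun x => x)
    (V := (k + 1 : ℕ) * (sigmaTilde (betaCoeff P) v a ^ 2 / a)) (by positivity)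
    (fun l => (hρe l).1) (fun l hl hl3 => ?_) hL
  · set t := √(2 * ((k + 1 : ℕ) * (sigmaTilde (betaCoeff P) v a ^ 2 / a)) * L) + L / 3
    have hA : MeasurableSet {x : ℝ | t < x} := measurableSet_lt measurable_const measurable_id
    have h := (abs_le.1 (hρA _ hA)).2
    rw [map_measureReal_apply (Finset.measurable_sum _ fun j _ => hW _) hA] at h
    change P.real {z | t < ∑ j ∈ Finset.range (k + 1),
      centeredBlockMean f p a (c + 2 * a * j) z} - _ ≤ _ at h
    push_cast
    linarith
  · rw [(hρe l).2]
    calc _ ≤ Real.exp (sigmaTilde (betaCoeff P) v a ^ 2 / a * (l ^ 2 / (2 * (1 - l / 3))))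
            ^ (k + 1) :=
          pow_le_pow_left₀ (integral_nonneg fun _ => (Real.exp_pos _).le)
            (integral_exp_le_of_abs_le_one P (hW 0)
              (abs_centeredBlockMean_le h0 h1 hp0 hp1 0) hmean hvar hl hl3) _
      _ = _ := by
          rw [← Real.exp_nat_mul]
          congr 1
          ring

/-- Two-sided Bernstein inequality for sums over alternate blocks of a stationary sequence. -/
theorem IsStationaryLaw.measureReal_abs_block_sum_gt_le [IsProbabilityMeasure P]
    (hP : IsStationaryLaw P) (hf : Measurable f) (h0 : ∀ x, 0 ≤ f x) (h1 : ∀ x, f x ≤ 1)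
    {v : ℝ} (hp : ∫ z, f (z 0) ∂P = p) (hv : ∫ z, (f (z 0) - p) ^ 2 ∂P = v) {m : ℕ}
    (hm : 1 ≤ m) (ha : 1 ≤ a) (c : ℕ) {L : ℝ} (hL : 0 < L) :
    P.real {z | √(2 * (m * (sigmaTilde (betaCoeff P) v a ^ 2 / a)) * L) + L / 3
        < |∑ j ∈ Finset.range m, centeredBlockMean f p a (c + 2 * a * j) z|}
      ≤ 2 * (Real.exp (-L) + (m - 1) * betaCoeff P a) := by
  have hup := hP.measureReal_block_sum_gt_le hf h0 h1 hp hv hm ha c hL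
  have hfi : Integrable (fun z : ℤ → E => f (z 0)) P :=
    Integrable.of_bound (hf.comp (measurable_pi_apply _)).aestronglyMeasurable 1
      (ae_of_all _ fun z => by rw [Real.norm_of_nonneg (h0 _)]; exact h1 _)
  -- Passing from `f` to `1 - f` flips the sign of every block mean and keeps the range and
  -- variance, so the upper bound gives the lower tail.
  have hlo := hP.measureReal_block_sum_gt_le (f := fun x => 1 - f x) (p := 1 - p) (v := v)
    (by fun_prop) (fun x => sub_nonneg.2 (h1 x)) (fun x => sub_le_self _ (h0 x))
    (by rw [integral_sub (integrable_const _) hfi, hp]; simp)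
    (by rw [← hv]; congr 1; funext z; ring) hm ha c hL
  have hneg : ∀ c z, centeredBlockMean (fun x => 1 - f x) (1 - p) a c z
      = -centeredBlockMean f p a c z := fun c z => by
    simp only [centeredBlockMean]
    rw [← neg_div, ← Finset.sum_neg_distrib]
    congr 1
    exact Finset.sum_congr rfl fun i _ => by ring
  simp_rw [hneg, Finset.sum_neg_distrib] at hlo
  simp_rw [lt_abs, Set.ofPred_or]
  refine (measureReal_union_le _ _).trans ?_
  linarith

end Blocks

/-! ### From block sums to the sample mean, and from the process to the sample. -/

section Sample

theorem sum_range_two_mul_mul (g : ℕ → ℝ) (m a : ℕ) :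
    ∑ i ∈ Finset.range (2 * m * a), g i
      = ∑ j ∈ Finset.range m, ∑ i ∈ Finset.range a, g (2 * a * j + i)
        + ∑ j ∈ Finset.range m, ∑ i ∈ Finset.range a, g (a + 2 * a * j + i) := by
  induction m with
  | zero => simp
  | succ m ih =>
    rw [show 2 * (m + 1) * a = 2 * m * a + a + a by ring, Finset.sum_range_add,
      Finset.sum_range_add, ih, Finset.sum_range_succ _ m, Finset.sum_range_succ _ m,
      show 2 * m * a = 2 * a * m by ring, show 2 * a * m + a = a + 2 * a * m by ring]
    ring

theorem abs_sub_mean_le_of_block_sums {m a s n : ℕ} (hn : n = 2 * m * a + s) (hn0 : 0 < n)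
    (ha : 1 ≤ a) {x : ℕ → ℝ} (hx : ∀ i ∈ Finset.Icc 1 n, x i ∈ Set.Icc (0 : ℝ) 1) {p t : ℝ}
    (hp : p ∈ Set.Icc (0 : ℝ) 1)
    (hodd : |∑ j ∈ Finset.range m,
      (∑ i ∈ Finset.range a, (x (0 + 2 * a * j + i + 1) - p)) / a| ≤ t)
    (heven : |∑ j ∈ Finset.range m,
      (∑ i ∈ Finset.range a, (x (a + 2 * a * j + i + 1) - p)) / a| ≤ t) :
    |p - 1 / (n : ℝ) * ∑ i ∈ Finset.Icc 1 n, x i| ≤ 2 * a * t / n + s / n := by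
  have ha' : (0 : ℝ) < a := by exact_mod_cast ha
  have hn' : (0 : ℝ) < n := by exact_mod_cast hn0
  rw [← Finset.sum_div, abs_div, abs_of_pos ha', div_le_iff₀ ha'] at hodd heven
  simp only [zero_add] at hodd
  have hsum : ∑ i ∈ Finset.range n, (x (i + 1) - p)
      = ∑ j ∈ Finset.range m, ∑ i ∈ Finset.range a, (x (2 * a * j + i + 1) - p)
        + ∑ j ∈ Finset.range m, ∑ i ∈ Finset.range a, (x (a + 2 * a * j + i + 1) - p)
        + ∑ i ∈ Finset.range s, (x (2 * m * a + i + 1) - p) := by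
    rw [hn, Finset.sum_range_add, sum_range_two_mul_mul fun i => x (i + 1) - p]
  have hrest : |∑ i ∈ Finset.range s, (x (2 * m * a + i + 1) - p)| ≤ s := by
    refine (Finset.abs_sum_le_sum_abs _ _).trans
      ((Finset.sum_le_card_nsmul _ _ 1 fun i hi => ?_).trans (by simp))
    have hi := Finset.mem_range.1 hi
    have h := hx (2 * m * a + i + 1) (Finset.mem_Icc.2 (by lia))
    rw [abs_le]
    constructor <;> linarith [h.1, h.2, hp.1, hp.2]
  have hdev : p - 1 / (n : ℝ) * ∑ i ∈ Finset.Icc 1 n, x i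
      = -(∑ i ∈ Finset.range n, (x (i + 1) - p)) / n := by
    have : ∑ i ∈ Finset.Icc 1 n, x i = ∑ i ∈ Finset.range n, x (i + 1) := by
      rw [← Finset.Ico_add_one_right_eq_Icc, Finset.sum_Ico_eq_sum_range]
      simp [add_comm]
    rw [this, Finset.sum_sub_distrib]
    simp only [Finset.sum_const, Finset.card_range, nsmul_eq_mul]
    field_simp
    ring
  rw [hdev, abs_div, abs_neg, abs_of_pos hn', ← add_div, hsum]
  gcongr
  refine (abs_add_three _ _ _).trans ?_
  linarith

/-- Both terms reduce to `2ma ≤ n`. After squaring, the square-root term compares `4σ²L · 2ma` with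
`4σ²L · n`. -/
theorem two_mul_mul_block_bound_div_le {m a s n : ℕ} (hn : n = 2 * m * a + s) (hm : 1 ≤ m)
    (ha : 1 ≤ a) {σ L : ℝ} (hσ : 0 ≤ σ) (hL : 0 ≤ L) :
    2 * a * (√(2 * (m * (σ ^ 2 / a)) * L) + L / 3) / n
      ≤ σ * √(4 / (n : ℝ) * L) + 1 / (3 * (m : ℝ)) * L := by
  have ha' : (0 : ℝ) < a := by exact_mod_cast ha
  have hm' : (0 : ℝ) < m := by exact_mod_cast hm
  have hle : 2 * (m : ℝ) * a ≤ n := by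
    rw [hn]
    push_cast
    linarith [Nat.cast_nonneg (α := ℝ) s]
  have hn' : (0 : ℝ) < n := lt_of_lt_of_le (by positivity) hle
  have h1 : 2 * a * √(2 * (m * (σ ^ 2 / a)) * L) / n ≤ σ * √(4 / (n : ℝ) * L) := by
    rw [div_le_iff₀ hn']
    refine le_of_sq_le_sq ?_ (by positivity)
    rw [mul_pow (2 * (a : ℝ)), mul_pow (σ * √(4 / (n : ℝ) * L)), mul_pow σ,
      Real.sq_sqrt (by positivity), Real.sq_sqrt (by positivity)]
    have e1 : (2 * (a : ℝ)) ^ 2 * (2 * (m * (σ ^ 2 / a)) * L) = 4 * σ ^ 2 * L * (2 * m * a) := by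
      field_simp
      ring
    have e2 : σ ^ 2 * (4 / (n : ℝ) * L) * n ^ 2 = 4 * σ ^ 2 * L * n := by
      field_simp
    rw [e1, e2]
    gcongr
  have h2 : 2 * a * (L / 3) / n ≤ 1 / (3 * (m : ℝ)) * L := by
    rw [div_le_iff₀ hn']
    calc 2 * a * (L / 3) = 1 / (3 * (m : ℝ)) * L * (2 * m * a) := by field_simp
      _ ≤ _ := by gcongr
  rw [mul_add, add_div]
  exact add_le_add h1 h2

/-- Two-sided extension of a finite sample. -/
noncomputable def extendSample (n : ℕ) (w : Set.Icc 1 n → ℝ) (t : ℤ) : ℝ :=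
  -- Nonpositive times have `toNat` equal to 0, so they too get the default 0, which functions of
  -- the times `1, …, n` never see.
  if h : t.toNat ∈ Set.Icc 1 n then w ⟨t.toNat, h⟩ else 0

theorem measurable_extendSample (n : ℕ) : Measurable (extendSample n) := by
  refine measurable_pi_lambda _ fun t => ?_
  unfold extendSample
  split_ifs
  · exact measurable_pi_apply _
  · exact measurable_const

theorem extendSample_natCast {n i : ℕ} (w : Set.Icc 1 n → ℝ) (hi : i ∈ Set.Icc 1 n) :
    extendSample n w i = w ⟨i, hi⟩ := by
  simp only [extendSample, Int.toNat_natCast]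
  rw [dif_pos hi]

/-- Events that only involve the times `1, …, n` have the same probability under the sample. -/
theorem measureReal_extendSample_preimage {P : Measure (ℤ → ℝ)} {n : ℕ} {Ω : Type*}
    [MeasurableSpace Ω] {μ : Measure Ω} {Z : ℕ → Ω → ℝ}
    (hZ : HasLaw (fun ω (i : Set.Icc 1 n) => Z i ω)
      (P.map (fun z (i : Set.Icc 1 n) => z ((i : ℕ) : ℤ))) μ)
    {F : (ℤ → ℝ) → ℝ} (hF : Measurable F)
    (hFd : DependsOn F ((fun i : ℕ => (i : ℤ)) '' Set.Icc 1 n)) {A : Set ℝ}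
    (hA : MeasurableSet A) :
    μ.real {ω | F (extendSample n fun i => Z i ω) ∈ A} = P.real {z | F z ∈ A} := by
  have hFe : Measurable fun w => F (extendSample n w) := hF.comp (measurable_extendSample n)
  rw [hZ.measureReal_eq (p := fun w => F (extendSample n w) ∈ A) (hFe hA),
    map_measureReal_apply (measurable_pi_lambda _ fun _ => measurable_pi_apply _) (hFe hA)]
  congr 1
  ext z
  have : F (extendSample n fun i => z (i : ℕ)) = F z :=
    hFd fun t ht => by
      obtain ⟨i, hi, rfl⟩ := ht
      exact extendSample_natCast _ hi
  simp [this]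

theorem hasLaw_eval_natCast {P : Measure (ℤ → ℝ)} {n : ℕ} {Ω : Type*} [MeasurableSpace Ω]
    {μ : Measure Ω} {Z : ℕ → Ω → ℝ} (hP : IsStationaryLaw P)
    (hZ : HasLaw (fun ω (i : Set.Icc 1 n) => Z i ω)
      (P.map (fun z (i : Set.Icc 1 n) => z ((i : ℕ) : ℤ))) μ)
    {i : ℕ} (hi : i ∈ Set.Icc 1 n) : HasLaw (Z i) (P.map fun z => z 0) μ := by
  have hev : Measurable fun w : Set.Icc 1 n → ℝ => w ⟨i, hi⟩ := measurable_pi_apply _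
  have hr : Measurable fun (z : ℤ → ℝ) (i : Set.Icc 1 n) => z ((i : ℕ) : ℤ) :=
    measurable_pi_lambda _ fun _ => measurable_pi_apply _
  have hs := hP.measurePreserving_shift i
  refine ⟨hev.comp_aemeasurable hZ.aemeasurable, ?_⟩
  have h1 : μ.map (Z i) = (μ.map fun ω (i : Set.Icc 1 n) => Z i ω).map fun w => w ⟨i, hi⟩ := by
    rw [AEMeasurable.map_map_of_aemeasurable hev.aemeasurable hZ.aemeasurable]
    rfl
  rw [h1, hZ.map_eq, Measure.map_map hev hr]
  conv_rhs => rw [← hs.map_eq, Measure.map_map (measurable_pi_apply 0) hs.measurable]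
  congr 1
  funext z
  simp

end Sample

/-! ### The deviation bound. -/

theorem mainTheorem5
    -- a stationary `β`-mixing distribution on two-sided real sequences
    (P : Measure (ℤ → ℝ)) [IsProbabilityMeasure P]
    (hstat : IsStationaryLaw P) (hmix : IsBetaMixing P)
    (m a s n : ℕ) (hm : 1 ≤ m) (ha : 1 ≤ a) (hn : n = 2 * m * a + s)
    -- a sample `Z₁, …, Zₙ` drawn from it, on an arbitrary probability space
    {Ω : Type*} [MeasurableSpace Ω] (μ : Measure Ω) [IsProbabilityMeasure μ]
    (Z : ℕ → Ω → ℝ)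
    (hZ : HasLaw (fun ω (i : Set.Icc 1 n) => Z i ω)
      (P.map (fun z (i : Set.Icc 1 n) => z ((i : ℕ) : ℤ))) μ)
    (hZ01 : ∀ᵐ ω ∂μ, Z 1 ω ∈ Set.Icc (0 : ℝ) 1)
    (v : ℝ) (hv : Var[Z 1; μ] = v)
    (δ : ℝ) (hδ : 4 * ((m : ℝ) - 1) * betaCoeff P a < δ) :
    1 - δ ≤ μ.real {ω |
      |(∫ ω', Z 1 ω' ∂μ) - 1 / (n : ℝ) * ∑ i ∈ Finset.Icc 1 n, Z i ω| ≤
        sigmaTilde (betaCoeff P) v a *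
            √(4 / (n : ℝ) * Real.log (4 / (δ - 4 * ((m : ℝ) - 1) * betaCoeff P a)))
          + 1 / (3 * (m : ℝ)) * Real.log (4 / (δ - 4 * ((m : ℝ) - 1) * betaCoeff P a))
          + (s : ℝ) / (n : ℝ)} := by
  have hm' : (1 : ℝ) ≤ m := by exact_mod_cast hm
  have hβ : 0 ≤ ((m : ℝ) - 1) * betaCoeff P a :=
    mul_nonneg (sub_nonneg.2 hm') (betaCoeff_nonneg P a)
  rcases le_or_gt 1 δ with hδ1 | hδ1
  · exact (sub_nonpos.2 hδ1).trans measureReal_nonneg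
  set η := δ - 4 * ((m : ℝ) - 1) * betaCoeff P a with hη
  have hη0 : 0 < η := sub_pos.2 hδ
  have hη1 : η < 1 := by linarith
  set L := Real.log (4 / η) with hLdef
  have hL : 0 < L := Real.log_pos (by rw [lt_div_iff₀ hη0]; linarith)
  have hexp : Real.exp (-L) = η / 4 := by
    rw [Real.exp_neg, hLdef, Real.exp_log (by positivity), inv_div]
  have hma : 1 ≤ m * a := Nat.mul_pos hm ha
  have hn0 : 1 ≤ n := by
    rw [hn, mul_assoc]
    lia
  have hlaw : ∀ i ∈ Set.Icc 1 n, HasLaw (Z i) (P.map fun z => z 0) μ := fun i hi =>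
    hasLaw_eval_natCast hstat hZ hi
  have hlaw1 := hlaw 1 ⟨le_rfl, hn0⟩
  have hmeas01 : Measurable fun x : ℝ => x ∈ Set.Icc (0 : ℝ) 1 :=
    measurableSet_Icc.mem
  have hP01 : ∀ᵐ x ∂(P.map fun z : ℤ → ℝ => z 0), x ∈ Set.Icc (0 : ℝ) 1 :=
    (hlaw1.ae_iff hmeas01).1 hZ01
  have hall : ∀ᵐ ω ∂μ, ∀ i ∈ Finset.Icc 1 n, Z i ω ∈ Set.Icc (0 : ℝ) 1 := by
    rw [Finset.eventually_all]
    exact fun i hi => ((hlaw i (Finset.mem_Icc.1 hi)).ae_iff hmeas01).2 hP01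
  -- The block estimates need pointwise bounds, while the sample is in `[0, 1]` only almost surely.
  -- Clipping supplies the former and almost surely leaves the sample unchanged.
  set f : ℝ → ℝ := fun x => max 0 (min 1 x) with hf
  have hfm : Measurable f := by fun_prop
  have h0 : ∀ x, 0 ≤ f x := fun x => le_max_left _ _
  have h1 : ∀ x, f x ≤ 1 := fun x => max_le zero_le_one (min_le_left _ _)
  have hfid : ∀ x ∈ Set.Icc (0 : ℝ) 1, f x = x := fun x hx => by
    simp only [hf]
    rw [min_eq_right hx.2, max_eq_right hx.1]
  have htransfer : ∀ g : ℝ → ℝ, Measurable g → ∫ z, g (f (z 0)) ∂P = ∫ ω, g (Z 1 ω) ∂μ := by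
    intro g hg
    have e1 := integral_map (μ := P) (measurable_pi_apply (0 : ℤ)).aemeasurable
      (f := fun x : ℝ => g (f x)) (hg.comp hfm).aestronglyMeasurable
    have e2 := hlaw1.integral_comp (f := fun x : ℝ => g (f x))
      (hg.comp hfm).aestronglyMeasurable
    rw [← e1, ← e2]
    refine integral_congr_ae ?_
    filter_upwards [hZ01] with ω hω
    simp only [Function.comp_apply]
    rw [hfid _ hω]
  set p := ∫ ω', Z 1 ω' ∂μ with hp
  have hp' : ∫ z, f (z 0) ∂P = p := htransfer (fun x => x) measurable_id
  have hv' : ∫ z, (f (z 0) - p) ^ 2 ∂P = v := by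
    rw [htransfer (fun x => (x - p) ^ 2) (by fun_prop), ← hv,
      variance_eq_integral hlaw1.aemeasurable]
  have hp01 : p ∈ Set.Icc (0 : ℝ) 1 := by
    rw [← hp']
    refine ⟨integral_nonneg fun z => h0 _, ?_⟩
    exact (integral_mono_of_nonneg (ae_of_all _ fun z => h0 _) (integrable_const 1)
      (ae_of_all _ fun z => h1 _)).trans (by simp)
  set t := √(2 * (m * (sigmaTilde (betaCoeff P) v a ^ 2 / a)) * L) + L / 3 with ht
  -- Offset `c = 0` gives the odd blocks and `c = a` the even ones.
  set B : ℕ → (ℤ → ℝ) → ℝ := fun c z =>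
    ∑ j ∈ Finset.range m, centeredBlockMean f p a (c + 2 * a * j) z with hB
  have hbad : ∀ c ≤ a, μ.real {ω | t < |B c (extendSample n fun i => Z i ω)|}
      ≤ 2 * (η / 4 + (m - 1) * betaCoeff P a) := by
    intro c hc
    rw [← hexp]
    refine le_trans (le_of_eq ?_)
      (hstat.measureReal_abs_block_sum_gt_le hfm h0 h1 hp' hv' hm ha c hL)
    refine measureReal_extendSample_preimage hZ (F := B c) (A := {x | t < |x|})
      (Finset.measurable_sum _ fun j _ => measurable_centeredBlockMean hfm p a _) ?_
      (measurableSet_lt measurable_const measurable_id.abs)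
    intro x y hxy
    refine Finset.sum_congr rfl fun j hj => dependsOn_centeredBlockMean _ (fun i hi => ?_) hxy
    refine ⟨_, ⟨by lia, ?_⟩, rfl⟩
    have hj : a * (j + 1) ≤ a * m := Nat.mul_le_mul_left _ (Finset.mem_range.1 hj)
    rw [hn, show 2 * m * a = 2 * (a * m) by ring, show 2 * a * j = 2 * (a * j) by ring]
    rw [mul_add] at hj
    lia
  set S := {ω | |p - 1 / (n : ℝ) * ∑ i ∈ Finset.Icc 1 n, Z i ω| ≤
    sigmaTilde (betaCoeff P) v a * √(4 / (n : ℝ) * L) + 1 / (3 * (m : ℝ)) * L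
      + (s : ℝ) / (n : ℝ)} with hS
  have hsub : ∀ᵐ ω ∂μ, ω ∈ Sᶜ → ω ∈ {ω | t < |B 0 (extendSample n fun i => Z i ω)|}
      ∪ {ω | t < |B a (extendSample n fun i => Z i ω)|} := by
    filter_upwards [hall] with ω hω
    contrapose!
    intro hgood
    simp only [Set.mem_union, Set.mem_ofPred_eq, not_or, not_lt] at hgood
    have hblock : ∀ c ≤ a, B c (extendSample n fun i => Z i ω) = ∑ j ∈ Finset.range m,
        (∑ i ∈ Finset.range a, (Z (c + 2 * a * j + i + 1) ω - p)) / a := by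
      intro c hc
      refine Finset.sum_congr rfl fun j hj => ?_
      unfold centeredBlockMean
      congr 1
      refine Finset.sum_congr rfl fun i hi => ?_
      have hi := Finset.mem_range.1 hi
      have hmem : c + 2 * a * j + i + 1 ∈ Set.Icc 1 n := by
        refine ⟨by lia, ?_⟩
        have hj : a * (j + 1) ≤ a * m := Nat.mul_le_mul_left _ (Finset.mem_range.1 hj)
        rw [hn, show 2 * m * a = 2 * (a * m) by ring, show 2 * a * j = 2 * (a * j) by ring]
        rw [mul_add] at hj
        lia
      rw [extendSample_natCast _ hmem, hfid _ (hω _ (Finset.mem_Icc.2 hmem))]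
    rw [hblock 0 (Nat.zero_le _), hblock a le_rfl] at hgood
    rw [Set.notMem_compl_iff]
    refine (abs_sub_mean_le_of_block_sums hn hn0 ha (x := fun i => Z i ω) hω hp01
      hgood.1 hgood.2).trans ?_
    gcongr
    exact two_mul_mul_block_bound_div_le hn hm ha (Real.sqrt_nonneg _) hL.le
  -- The right side equals `η + 4 (m - 1) β(a) = δ`.
  have hcompl : μ.real Sᶜ ≤ 4 * (η / 4 + (m - 1) * betaCoeff P a) := by
    refine (ENNReal.toReal_mono (measure_ne_top _ _) (measure_mono_ae hsub)).trans ?_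
    refine (measureReal_union_le _ _).trans ?_
    linarith [hbad 0 (Nat.zero_le _), hbad a le_rfl]
  have huniv : 1 ≤ μ.real S + μ.real Sᶜ := by
    rw [← probReal_univ (μ := μ), ← Set.union_compl_self S]
    exact measureReal_union_le _ _
  linarith
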